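/- Let $V\in C^\infty(\mathbb R)$ be real-valued and even, $V(-x)=V(x)$, and suppose $V=V_{\rm per}+V_{\rm def}$, where $V_{\rm per}(x+1)=V_{\rm per}(x)$ for all $x$ and, for some $\rho\ge 0$, $V_{\rm def}(x)=0$ whenever $|x|>\rho$. Let $E>0$ and let $\Phi\in L^2(\mathbb R)$, $\Phi\neq 0$, be a bound state: $-\Phi''+V\Phi=E\Phi$. (Then $\Phi$ is either even or odd.) For $z\in\mathbb C$ let $u_z,v_z$ be the solutions of $-\psi''+V\psi=z\psi$ with $$u_z(0)=1,\ u_z'(0)=0,\quad v_z(0)=0,\ v_z'(0)=1\qquad\text{if }\Phi\text{ is even},$$ $$u_z(0)=0,\ u_z'(0)=1,\quad v_z(0)=-1,\ v_z'(0)=0\qquad\text{if }\Phi\text{ is odd}.$$ For $M>0$ and $z\in\mathbb C\setminus(-\infty,0]$ put $\Theta(z)=\Theta_M(z):=u_z'(M)-i\sqrt z\,u_z(M)$, with the principal branch of the square root. Let $k$ be the logarithm of the largest modulus of a characteristic (Floquet) multiplier of the periodic equation $-\psi''+V_{\rm per}\psi=E\psi$, i.e. of a number $\mu\in\mathbb C$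 for which this equation has a nonzero solution with $\psi(x+1)=\mu\psi(x)$ for all $x$. Then $k>0$, and there are constants $C$ and $M_0>\rho$ such that for all $M\ge M_0$ the function $\Theta$ is complex differentiable at $E$, $\partial_z\Theta(E)\ne0$, $\left[(v_E'(M))^2+E(v_E(M))^2\right]\int_0^M u_E^2(y)\,dy\neq0$, and $$\left|\frac{\Theta(E)}{\partial_z\Theta(E)}-\frac{i\sqrt E-\left[u_E'(M)v_E'(M)+E\,u_E(M)v_E(M)\right]}{\left[(v_E'(M))^2+E(v_E(M))^2\right]\int_0^M u_E^2(y)\,dy}\right|\le C\,M\,e^{-4kM}.$$ -/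

import Mathlib

/-- `ψ` is a classical (twice differentiable) solution on `ℝ` of `(D_x² + V - z) ψ = 0`,
that is, of `-ψ'' + V ψ = z ψ`. -/
def IsSchrodingerSolution (V : ℝ → ℝ) (z : ℂ) (ψ : ℝ → ℂ) : Prop :=
  Differentiable ℝ ψ ∧ Differentiable ℝ (deriv ψ) ∧
    ∀ x : ℝ, -deriv (deriv ψ) x + (V x : ℂ) * ψ x = z * ψ x

/-- `ψ` is the solution of `-ψ'' + V ψ = z ψ` with `ψ(0) = a`, `ψ'(0) = b`. -/
def IsCauchySolution (V : ℝ → ℝ) (z a b : ℂ) (ψ : ℝ → ℂ) : Prop :=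
  IsSchrodingerSolution V z ψ ∧ ψ 0 = a ∧ deriv ψ 0 = b

/-- `Φ` is a bound state of `H = D_x² + V` with energy `E`: a nonzero square-integrable
solution of `H Φ = E Φ`. -/
def IsBoundState (V : ℝ → ℝ) (E : ℝ) (Φ : ℝ → ℂ) : Prop :=
  Φ ≠ 0 ∧ MeasureTheory.MemLp Φ 2 MeasureTheory.volume ∧ IsSchrodingerSolution V (E : ℂ) Φ

/-- `u z` and `v z` are, for every `z`, the two normalized solutions attached to the bound
state `Φ`. If `Φ` is even, `u z` has Cauchy data `(1, 0)` and `v z` has `(0, 1)` at the origin;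
if `Φ` is odd, `u z` has Cauchy data `(0, 1)` and `v z` has `(-1, 0)`. -/
def IsNormalizedPair (V : ℝ → ℝ) (Φ : ℝ → ℂ) (u v : ℂ → ℝ → ℂ) : Prop :=
  (Function.Even Φ → ∀ z : ℂ, IsCauchySolution V z 1 0 (u z) ∧ IsCauchySolution V z 0 1 (v z)) ∧
  (Function.Odd Φ → ∀ z : ℂ, IsCauchySolution V z 0 1 (u z) ∧ IsCauchySolution V z (-1) 0 (v z))

/-- `Θ(z) = u_z'(M) - i √z u_z(M)`, with the principal branch of the square root. -/
noncomputable def Theta (u : ℂ → ℝ → ℂ) (M : ℝ) (z : ℂ) : ℂ :=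
  deriv (u z) M - Complex.I * z ^ (1 / 2 : ℂ) * u z M

/-- `μ` is a characteristic (Floquet) multiplier of the `1`-periodic equation
`-ψ'' + W ψ = E ψ`. -/
def IsFloquetMultiplier (W : ℝ → ℝ) (E : ℝ) (μ : ℂ) : Prop :=
  ∃ ψ : ℝ → ℂ, ψ ≠ 0 ∧ IsSchrodingerSolution W (E : ℂ) ψ ∧ ∀ x : ℝ, ψ (x + 1) = μ * ψ x

/-- The explicit first-order correction
`(i√E - [u_E'(M) v_E'(M) + E u_E(M) v_E(M)]) / ([v_E'(M)² + E v_E(M)²] ∫₀ᴹ u_E²)`. -/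
noncomputable def explicitCorrection (u v : ℂ → ℝ → ℂ) (E M : ℝ) : ℂ :=
  (Complex.I * (Real.sqrt E : ℂ)
      - (deriv (u E) M * deriv (v E) M + (E : ℂ) * u E M * v E M)) /
    ((deriv (v E) M ^ 2 + (E : ℂ) * v E M ^ 2) * ∫ y in (0 : ℝ)..M, u E y ^ 2)

/-! Write u, v for u_E, v_E and, at the point M, p = u' - i√E u, q = v' - i√E v, A = ∫₀ᴹ u², B = ∫₀ᴹ
uv. Variation of constants in z gives ∂_z u = uB - vA at E, so Θ(E) = p and Θ'(E) = -qA + r with r =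
pB - i(√z)'u. If u, u' are O(e^{-kM}) and v is O(e^{kM}), then p = O(e^{-kM}), uv is bounded and r =
O(M e^{-kM}), while uv' - u'v = 1 forces |q| ≥ c e^{kM}. Hence Θ/Θ' = -p/(qA) + O(|p||r|/|qA|²),
with error O(M e^{-4kM}). Since u and v are real, expanding the quotient by the conjugate of q turns
-p/(qA) into the explicit correction; its i√E comes from the Wronskian (`exists_expansion`).

The rates come from Floquet theory. By parity u is a multiple of Φ, so it is square integrable, and
the equation then gives u, u' → 0 (`SolvesOn.tendsto_zero`). Beyond ρ, translation by one period
acts on the solution space and preserves Wronskians; decay makes u an eigenvector with eigenvalue a,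
|a| < 1, and the other eigenvalue is a⁻¹ (`SolvesOn.exists_floquet`). Every nonzero multiplier is
one of these two, so k = -log|a|. -/

open Set Filter Topology

/-! ### Solutions, Wronskians and uniqueness -/

/-- On `s`, the pair `(f, f')` solves the first-order system of `f'' = Q f`. -/
def SolvesOn (s : Set ℝ) (Q f f' : ℝ → ℂ) : Prop :=
  ∀ x ∈ s, HasDerivAt f (f' x) x ∧ HasDerivAt f' (Q x * f x) x

theorem IsSchrodingerSolution.solvesOn {V : ℝ → ℝ} {z : ℂ} {ψ : ℝ → ℂ}
    (h : IsSchrodingerSolution V z ψ) (s : Set ℝ) :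
    SolvesOn s (fun x => (V x : ℂ) - z) ψ (deriv ψ) := by
  intro x _
  refine ⟨(h.1 x).hasDerivAt, ?_⟩
  have h2 := (h.2.1 x).hasDerivAt
  have h3 := h.2.2 x
  have : deriv (deriv ψ) x = ((V x : ℂ) - z) * ψ x := by linear_combination -h3
  rwa [this] at h2

namespace SolvesOn

variable {s t : Set ℝ} {Q Q₁ Q₂ f f' g g' : ℝ → ℂ}

theorem mono (h : SolvesOn s Q f f') (hts : t ⊆ s) : SolvesOn t Q f f' :=
  fun x hx => h x (hts hx)

theorem congr_potential (h : SolvesOn s Q₁ f f') (hQ : ∀ x ∈ s, Q₁ x = Q₂ x) :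
    SolvesOn s Q₂ f f' :=
  fun x hx => ⟨(h x hx).1, hQ x hx ▸ (h x hx).2⟩

theorem continuousOn (h : SolvesOn s Q f f') : ContinuousOn f s :=
  fun x hx => (h x hx).1.continuousAt.continuousWithinAt

theorem continuousOn' (h : SolvesOn s Q f f') : ContinuousOn f' s :=
  fun x hx => (h x hx).2.continuousAt.continuousWithinAt

theorem continuous (h : SolvesOn univ Q f f') : Continuous f :=
  continuousOn_univ.mp h.continuousOn

theorem continuous' (h : SolvesOn univ Q f f') : Continuous f' :=
  continuousOn_univ.mp h.continuousOn'

theorem const_mul (h : SolvesOn s Q f f') (c : ℂ) :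
    SolvesOn s Q (fun x => c * f x) (fun x => c * f' x) := by
  intro x hx
  refine ⟨(h x hx).1.const_mul c, ?_⟩
  exact ((h x hx).2.const_mul c).congr_deriv (by ring)

theorem add (hf : SolvesOn s Q f f') (hg : SolvesOn s Q g g') :
    SolvesOn s Q (fun x => f x + g x) (fun x => f' x + g' x) := by
  intro x hx
  refine ⟨(hf x hx).1.add (hg x hx).1, ?_⟩
  exact ((hf x hx).2.add (hg x hx).2).congr_deriv (by ring)

theorem sub (hf : SolvesOn s Q f f') (hg : SolvesOn s Q g g') :
    SolvesOn s Q (fun x => f x - g x) (fun x => f' x - g' x) := by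
  intro x hx
  refine ⟨(hf x hx).1.sub (hg x hx).1, ?_⟩
  exact ((hf x hx).2.sub (hg x hx).2).congr_deriv (by ring)

theorem comp_add_const (h : SolvesOn s Q f f') (c : ℝ) :
    SolvesOn ((· + c) ⁻¹' s) (fun x => Q (x + c)) (fun x => f (x + c)) (fun x => f' (x + c)) :=
  fun x hx => ⟨(h (x + c) hx).1.comp_add_const x c, (h (x + c) hx).2.comp_add_const x c⟩

theorem comp_neg (h : SolvesOn univ Q f f') (hQ : ∀ x, Q (-x) = Q x) :
    SolvesOn univ Q (fun x => f (-x)) (fun x => -f' (-x)) := by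
  intro x _
  have h1 := (h (-x) trivial).1.scomp x (hasDerivAt_neg x)
  have h2 := ((h (-x) trivial).2.scomp x (hasDerivAt_neg x)).neg
  exact ⟨h1.congr_deriv (by simp), h2.congr_deriv (by simp [hQ])⟩

theorem conj (h : SolvesOn s Q f f') (hQ : ∀ x ∈ s, starRingEnd ℂ (Q x) = Q x) :
    SolvesOn s Q (fun x => starRingEnd ℂ (f x)) (fun x => starRingEnd ℂ (f' x)) := by
  intro x hx
  refine ⟨(h x hx).1.star, ?_⟩
  have := (h x hx).2.star
  simpa [hQ x hx] using this

theorem hasDerivAt_wronskian {x : ℝ} (hf : SolvesOn s Q₁ f f') (hg : SolvesOn s Q₂ g g')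
    (hx : x ∈ s) :
    HasDerivAt (fun y => f y * g' y - f' y * g y) ((Q₂ x - Q₁ x) * (f x * g x)) x := by
  exact (((hf x hx).1.mul (hg x hx).2).sub ((hf x hx).2.mul (hg x hx).1)).congr_deriv (by ring)

theorem wronskian_eq (hf : SolvesOn s Q f f') (hg : SolvesOn s Q g g') (hs : IsOpen s)
    (hs' : IsPreconnected s) {x y : ℝ} (hx : x ∈ s) (hy : y ∈ s) :
    f x * g' x - f' x * g x = f y * g' y - f' y * g y := by
  have key : ∀ x ∈ s, HasDerivAt (fun y => f y * g' y - f' y * g y) 0 x := by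
    intro x hx
    simpa using hasDerivAt_wronskian hf hg hx
  exact hs.is_const_of_deriv_eq_zero hs'
    (fun x hx => (key x hx).differentiableAt.differentiableWithinAt)
    (fun x hx => (key x hx).deriv) hx hy

/-- The identity for the Wronskian of solutions with two different potentials. -/
theorem integral_wronskian (hf : SolvesOn univ Q₁ f f') (hg : SolvesOn univ Q₂ g g') {c : ℂ}
    (hQ : ∀ x, Q₂ x - Q₁ x = c) (M : ℝ) :
    f M * g' M - f' M * g M
      = f 0 * g' 0 - f' 0 * g 0 + c * ∫ y in (0 : ℝ)..M, f y * g y := by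
  have hc : Continuous fun y => c * (f y * g y) :=
    continuous_const.mul (hf.continuous.mul hg.continuous)
  have := intervalIntegral.integral_eq_sub_of_hasDerivAt
    (f := fun y => f y * g' y - f' y * g y) (f' := fun y => c * (f y * g y)) (a := 0) (b := M)
    (fun x _ => by
      have := hasDerivAt_wronskian hf hg (mem_univ x)
      rwa [hQ] at this) (hc.intervalIntegrable _ _)
  rw [intervalIntegral.integral_const_mul] at this
  linear_combination -this

/-- A solution with vanishing Cauchy data at a point vanishes identically. -/
theorem eq_zero (hQ : Continuous Q) (h : SolvesOn univ Q f f') (h0 : f 0 = 0) (h0' : f' 0 = 0)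
    (x : ℝ) : f x = 0 := by
  set R := |x| + 1
  obtain ⟨K, hK⟩ := isCompact_Icc.exists_bound_of_continuousOn
    (hQ.continuousOn (s := Icc (-R) R))
  have hx : x ∈ Ioo (-R) R := by
    constructor <;> simp only [R] <;> [linarith [neg_abs_le x]; linarith [le_abs_self x]]
  have h0R : (0 : ℝ) ∈ Ioo (-R) R := by
    constructor <;> simp only [R] <;> linarith [abs_nonneg x]
  have hlip : ∀ t ∈ Ioo (-R) R, LipschitzOnWith (max 1 K).toNNReal
      (fun p : ℂ × ℂ => (p.2, Q t * p.1)) univ := by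
    intro t ht
    refine LipschitzOnWith.of_dist_le_mul fun p _ q _ => ?_
    have hK' := hK t (Ioo_subset_Icc_self ht)
    rw [Real.coe_toNNReal _ (le_trans zero_le_one (le_max_left 1 K)), Prod.dist_eq, Prod.dist_eq]
    have h1 : (0 : ℝ) ≤ max (dist p.1 q.1) (dist p.2 q.2) := le_max_of_le_left dist_nonneg
    apply max_le
    · calc dist p.2 q.2 ≤ 1 * max (dist p.1 q.1) (dist p.2 q.2) := by
            rw [one_mul]; exact le_max_right _ _
        _ ≤ _ := mul_le_mul_of_nonneg_right (le_max_left _ _) h1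
    · simp only [dist_eq_norm, ← mul_sub, norm_mul]
      simp only [dist_eq_norm] at h1
      exact mul_le_mul (hK'.trans (le_max_right _ _)) (le_max_left _ _) (norm_nonneg _)
        (le_trans zero_le_one (le_max_left 1 K))
  have := ODE_solution_unique_of_mem_Ioo (f := fun t => (f t, f' t))
    (g := fun _ => (0 : ℂ × ℂ)) (v := fun t p => (p.2, Q t * p.1)) (s := fun _ => univ) hlip h0R
    (fun t _ => ⟨(h t trivial).1.prodMk (h t trivial).2, trivial⟩)
    (fun t _ => ⟨by simpa using! hasDerivAt_const t (0 : ℂ × ℂ), trivial⟩)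
    (by simp [h0, h0']) hx
  exact congrArg Prod.fst this

/-- Two solutions with Wronskian one span the solution space. -/
theorem eq_combination {u u' v v' ψ ψ' : ℝ → ℂ} (hu : SolvesOn s Q u u')
    (hv : SolvesOn s Q v v') (hψ : SolvesOn s Q ψ ψ')
    (hw : ∀ x ∈ s, u x * v' x - u' x * v x = 1) (hs : IsOpen s) (hs' : IsPreconnected s) :
    ∃ α β : ℂ, ∀ x ∈ s, ψ x = α * u x + β * v x ∧ ψ' x = α * u' x + β * v' x := by
  rcases s.eq_empty_or_nonempty with rfl | ⟨y, hy⟩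
  · exact ⟨0, 0, fun x hx => hx.elim⟩
  -- Cramer's rule: the coefficients are Wronskians of ψ with v and u, hence constant on `s`, so one
  -- point y determines them.
  refine ⟨ψ y * v' y - ψ' y * v y, u y * ψ' y - u' y * ψ y, fun x hx => ?_⟩
  rw [← hψ.wronskian_eq hv hs hs' hx hy, ← hu.wronskian_eq hψ hs hs' hx hy]
  constructor
  · linear_combination (-ψ x) * hw x hx
  · linear_combination (-ψ' x) * hw x hx

end SolvesOn

/-! ### Decay of square-integrable solutions -/

theorem tendsto_integral_unit_interval_zero {g : ℝ → ℝ} (hg : MeasureTheory.Integrable g) :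
    Tendsto (fun x : ℝ => ∫ y in x..x + 1, g y) atTop (𝓝 0) := by
  have h1 := MeasureTheory.intervalIntegral_tendsto_integral_Ioi 0 hg.integrableOn
    (tendsto_id (α := ℝ) (x := atTop))
  have h2 := MeasureTheory.intervalIntegral_tendsto_integral_Ioi 0 hg.integrableOn
    (tendsto_atTop_add_const_right atTop (1 : ℝ) tendsto_id)
  have h3 := h2.sub h1
  rw [sub_self] at h3
  refine h3.congr fun x => ?_
  exact intervalIntegral.integral_interval_sub_left hg.intervalIntegrable hg.intervalIntegrable

/-- In place of Cauchy–Schwarz, |ψ| ≤ ε/2 + |ψ|²/(2ε) is integrated over a unit interval; once ∫|ψ|²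
< ε²/2 this gives at most 3ε/4. -/
theorem tendsto_integral_norm_unit_interval_zero {ψ : ℝ → ℂ} {ρ : ℝ}
    (hc : ContinuousOn ψ (Ioi ρ)) (hψ : MeasureTheory.MemLp ψ 2 MeasureTheory.volume) :
    Tendsto (fun x : ℝ => ∫ y in x..x + 1, ‖ψ y‖) atTop (𝓝 0) := by
  have hbnd : MeasureTheory.Integrable fun y => ‖ψ y‖ ^ 2 := hψ.integrable_norm_pow two_ne_zero
  have hlim := tendsto_integral_unit_interval_zero hbnd
  rw [Metric.tendsto_nhds]
  intro ε hε
  have h1 : ∀ᶠ x : ℝ in atTop, ∫ y in x..x + 1, ‖ψ y‖ ^ 2 < ε ^ 2 / 2 :=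
    hlim.eventually (gt_mem_nhds (by positivity))
  filter_upwards [h1, eventually_gt_atTop ρ] with x hx hxρ
  have hle : x ≤ x + 1 := by linarith
  have hsub : uIcc x (x + 1) ⊆ Ioi ρ := by
    rw [uIcc_of_le hle]
    exact fun y hy => lt_of_lt_of_le hxρ hy.1
  have hi1 : IntervalIntegrable (fun y => ‖ψ y‖) MeasureTheory.volume x (x + 1) :=
    (hc.mono hsub).norm.intervalIntegrable
  have hi2 : IntervalIntegrable (fun y => ε / 2 + ‖ψ y‖ ^ 2 / (2 * ε)) MeasureTheory.volume
      x (x + 1) := intervalIntegrable_const.add (hbnd.intervalIntegrable.div_const _)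
  have hnn : 0 ≤ ∫ y in x..x + 1, ‖ψ y‖ :=
    intervalIntegral.integral_nonneg hle fun y _ => norm_nonneg _
  have hmono := intervalIntegral.integral_mono_on hle hi1 hi2 fun y _ => by
    have : ε / 2 + ‖ψ y‖ ^ 2 / (2 * ε) - ‖ψ y‖ = (‖ψ y‖ - ε) ^ 2 / (2 * ε) := by
      field_simp; ring
    have h2 : 0 ≤ (‖ψ y‖ - ε) ^ 2 / (2 * ε) := by positivity
    linarith
  rw [intervalIntegral.integral_add intervalIntegrable_const
    (hbnd.intervalIntegrable.div_const _), intervalIntegral.integral_const,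
    intervalIntegral.integral_div] at hmono
  rw [Real.dist_eq, sub_zero, abs_of_nonneg hnn]
  have h3 : (∫ y in x..x + 1, ‖ψ y‖ ^ 2) / (2 * ε) < ε / 4 := by
    rw [div_lt_iff₀ (by positivity)]
    nlinarith
  simp only [add_sub_cancel_left, smul_eq_mul, one_mul] at hmono
  linarith

/-- Green's identity: (ηψ' - η'ψ)' = (ηQ - η'')ψ contains no ψ', and the conditions on η at x + 1
leave only the boundary term at x. The Cauchy data of η at x select which of ψ(x), ψ'(x) is
estimated. -/
theorem SolvesOn.norm_green_le {Q ψ ψ' : ℝ → ℂ} {ρ K x : ℝ} (hQ : ContinuousOn Q (Ioi ρ))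
    (hK : ∀ y ∈ Ioi ρ, ‖Q y‖ ≤ K) (h : SolvesOn (Ioi ρ) Q ψ ψ') (hx : ρ < x)
    {η η' η'' : ℝ → ℂ} (hη : ∀ y, HasDerivAt η (η' y) y) (hη' : ∀ y, HasDerivAt η' (η'' y) y)
    (hη'' : Continuous η'') {L : ℝ} (hb : ∀ y ∈ Icc x (x + 1), ‖η y‖ ≤ 1)
    (hb'' : ∀ y ∈ Icc x (x + 1), ‖η'' y‖ ≤ L) (h1 : η (x + 1) = 0) (h1' : η' (x + 1) = 0) :
    ‖η x * ψ' x - η' x * ψ x‖ ≤ (K + L) * ∫ y in x..x + 1, ‖ψ y‖ := by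
  have hle : x ≤ x + 1 := by linarith
  have hsub : uIcc x (x + 1) ⊆ Ioi ρ := by
    rw [uIcc_of_le hle]
    exact fun y hy => lt_of_lt_of_le hx hy.1
  have hηc : Continuous η := continuous_iff_continuousAt.2 fun y => (hη y).continuousAt
  have hψc := h.continuousOn.mono hsub
  have hcont : ContinuousOn (fun y => (η y * Q y - η'' y) * ψ y) (uIcc x (x + 1)) :=
    ((hηc.continuousOn.mul (hQ.mono hsub)).sub hη''.continuousOn).mul hψc
  have hftc := intervalIntegral.integral_eq_sub_of_hasDerivAt
    (f := fun y => η y * ψ' y - η' y * ψ y) (f' := fun y => (η y * Q y - η'' y) * ψ y)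
    (a := x) (b := x + 1)
    (fun y hy => (((hη y).mul (h y (hsub hy)).2).sub
      ((hη' y).mul (h y (hsub hy)).1)).congr_deriv (by ring)) hcont.intervalIntegrable
  have heq : ‖η x * ψ' x - η' x * ψ x‖ = ‖∫ y in x..x + 1, (η y * Q y - η'' y) * ψ y‖ := by
    rw [hftc, h1, h1']
    simp [norm_sub_rev]
  rw [heq, ← intervalIntegral.integral_const_mul]
  refine intervalIntegral.norm_integral_le_of_norm_le hle
    (Eventually.of_forall fun y hy => ?_) (hψc.norm.intervalIntegrable.const_mul _)
  rw [norm_mul]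
  refine mul_le_mul_of_nonneg_right ?_ (norm_nonneg _)
  have hy' : y ∈ Icc x (x + 1) := Ioc_subset_Icc_self hy
  calc ‖η y * Q y - η'' y‖ ≤ ‖η y‖ * ‖Q y‖ + ‖η'' y‖ := by
        rw [← norm_mul]; exact norm_sub_le _ _
    _ ≤ 1 * K + L := add_le_add (mul_le_mul (hb y hy') (hK y (lt_trans hx hy.1))
        (norm_nonneg _) zero_le_one) (hb'' y hy')
    _ = K + L := by ring

/-- A square-integrable solution with bounded potential decays together with its derivative. -/
theorem SolvesOn.tendsto_zero {Q ψ ψ' : ℝ → ℂ} {ρ K : ℝ} (hQ : ContinuousOn Q (Ioi ρ))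
    (hK : ∀ y ∈ Ioi ρ, ‖Q y‖ ≤ K) (h : SolvesOn (Ioi ρ) Q ψ ψ')
    (hψ : MeasureTheory.MemLp ψ 2 MeasureTheory.volume) :
    Tendsto ψ atTop (𝓝 0) ∧ Tendsto ψ' atTop (𝓝 0) := by
  have hlim := (tendsto_integral_norm_unit_interval_zero h.continuousOn hψ).const_mul (K + 6)
  rw [mul_zero] at hlim
  have hid : ∀ x y : ℝ, HasDerivAt (fun y : ℝ => ((y - x : ℝ) : ℂ)) 1 y := fun x y => by
    simpa using ((hasDerivAt_id y).sub_const x).ofReal_comp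
  constructor
  · refine squeeze_zero_norm' ?_ hlim
    filter_upwards [eventually_gt_atTop ρ] with x hx
    -- With t = y - x, η = t(1 - t)² has η(x) = 0, η'(x) = 1 and a double zero at t = 1, so the
    -- boundary term is -ψ(x).
    have := h.norm_green_le hQ hK hx
      (η := fun y => ((y - x : ℝ) : ℂ) - 2 * ((y - x : ℝ) : ℂ) ^ 2 + ((y - x : ℝ) : ℂ) ^ 3)
      (η' := fun y => 1 - 4 * ((y - x : ℝ) : ℂ) + 3 * ((y - x : ℝ) : ℂ) ^ 2)
      (η'' := fun y => -4 + 6 * ((y - x : ℝ) : ℂ)) (L := 6)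
      (fun y => (((hid x y).sub (((hid x y).pow 2).const_mul 2)).add
        ((hid x y).pow 3)).congr_deriv (by push_cast; ring))
      (fun y => ((((hid x y).const_mul 4).const_sub 1).add
        (((hid x y).pow 2).const_mul 3)).congr_deriv (by push_cast; ring))
      (by fun_prop)
      (fun y hy => by
        have h0 := hy.1
        have h1 := hy.2
        have e : ((y - x : ℝ) : ℂ) - 2 * ((y - x : ℝ) : ℂ) ^ 2 + ((y - x : ℝ) : ℂ) ^ 3
          = (((y - x) * (1 - (y - x)) ^ 2 : ℝ) : ℂ) := by push_cast; ring
        rw [e, Complex.norm_real, Real.norm_eq_abs, abs_le]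
        have h2 : (1 - (y - x)) ^ 2 ≤ 1 := by nlinarith
        constructor <;> nlinarith [sq_nonneg (1 - (y - x))])
      (fun y hy => by
        have h0 := hy.1
        have h1 := hy.2
        have e : (-4 + 6 * ((y - x : ℝ) : ℂ)) = ((-4 + 6 * (y - x) : ℝ) : ℂ) := by push_cast; ring
        rw [e, Complex.norm_real, Real.norm_eq_abs, abs_le]
        constructor <;> linarith)
      (by push_cast; ring) (by push_cast; ring)
    simpa using this
  · refine squeeze_zero_norm' ?_ hlim
    filter_upwards [eventually_gt_atTop ρ] with x hx
    -- Here η = 1 - 3t² + 2t³ has η(x) = 1, η'(x) = 0 and a double zero at t = 1, which isolates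
    -- ψ'(x).
    have := h.norm_green_le hQ hK hx
      (η := fun y => 1 - 3 * ((y - x : ℝ) : ℂ) ^ 2 + 2 * ((y - x : ℝ) : ℂ) ^ 3)
      (η' := fun y => -6 * ((y - x : ℝ) : ℂ) + 6 * ((y - x : ℝ) : ℂ) ^ 2)
      (η'' := fun y => -6 + 12 * ((y - x : ℝ) : ℂ)) (L := 6)
      (fun y => (((((hid x y).pow 2).const_mul 3).const_sub 1).add
        (((hid x y).pow 3).const_mul 2)).congr_deriv (by push_cast; ring))
      (fun y => (((hid x y).const_mul (-6)).add
        (((hid x y).pow 2).const_mul 6)).congr_deriv (by push_cast; ring))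
      (by fun_prop)
      (fun y hy => by
        have h0 := hy.1
        have h1 := hy.2
        have e : 1 - 3 * ((y - x : ℝ) : ℂ) ^ 2 + 2 * ((y - x : ℝ) : ℂ) ^ 3
          = ((1 - (y - x) ^ 2 * (3 - 2 * (y - x)) : ℝ) : ℂ) := by push_cast; ring
        rw [e, Complex.norm_real, Real.norm_eq_abs, abs_le]
        have h2 : (y - x) ^ 2 ≤ 1 := by nlinarith
        constructor <;> nlinarith [sq_nonneg (y - x)])
      (fun y hy => by
        have h0 := hy.1
        have h1 := hy.2
        have e : (-6 + 12 * ((y - x : ℝ) : ℂ)) = ((-6 + 12 * (y - x) : ℝ) : ℂ) := by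
          push_cast; ring
        rw [e, Complex.norm_real, Real.norm_eq_abs, abs_le]
        constructor <;> linarith)
      (by push_cast; ring) (by push_cast; ring)
    simpa using this

/-! ### Floquet theory on a half line -/

/-- A continuous function that is eventually `1`-periodic is bounded above on the half line. -/
theorem exists_bound_of_periodic_Ioi {g : ℝ → ℝ} {ρ : ℝ} (hg : Continuous g)
    (hper : ∀ x, ρ < x → g (x + 1) = g x) : ∃ C, 0 < C ∧ ∀ x, 0 ≤ x → g x ≤ C := by
  obtain ⟨C, hC⟩ := isCompact_Icc.exists_bound_of_continuousOn
    (hg.continuousOn (s := Icc (min 0 ρ) (ρ + 2)))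
  have hiter : ∀ (n : ℕ) (x : ℝ), ρ < x → g (x + n) = g x := by
    intro n
    induction n with
    | zero => intro x _; simp
    | succ n ih =>
      intro x hx
      have : x + ((n + 1 : ℕ) : ℝ) = (x + n) + 1 := by push_cast; ring
      rw [this, hper _ (by have : (0 : ℝ) ≤ n := n.cast_nonneg; linarith), ih x hx]
  refine ⟨max C 1, lt_max_of_lt_right one_pos, fun x hx => le_max_of_le_left ?_⟩
  rcases le_or_gt x (ρ + 2) with h | h
  · exact (le_abs_self _).trans (hC x ⟨(min_le_left _ _).trans hx, h⟩)
  -- Translating by ⌊x - (ρ + 1)⌋ periods brings x into [ρ + 1, ρ + 2), strictly beyond ρ.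
  · have h1 := Nat.floor_le (show 0 ≤ x - (ρ + 1) by linarith)
    have h2 := Nat.lt_floor_add_one (x - (ρ + 1))
    have h3 := hiter ⌊x - (ρ + 1)⌋₊ (x - ⌊x - (ρ + 1)⌋₊) (by linarith)
    rw [sub_add_cancel] at h3
    rw [h3]
    exact (le_abs_self _).trans (hC _ ⟨(min_le_right _ _).trans (by linarith), by linarith⟩)

theorem SolvesOn.shift_of_periodic {Q f f' : ℝ → ℂ} {ρ : ℝ} (h : SolvesOn (Ioi ρ) Q f f')
    (hQ : ∀ x, ρ < x → Q (x + 1) = Q x) :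
    SolvesOn (Ioi ρ) Q (fun x => f (x + 1)) (fun x => f' (x + 1)) :=
  ((h.comp_add_const 1).mono fun x (hx : ρ < x) =>
    show ρ < x + 1 by linarith).congr_potential hQ

theorem iterate_shift {f : ℝ → ℂ} {ρ : ℝ} {a : ℂ} (h : ∀ x, ρ < x → f (x + 1) = a * f x)
    (n : ℕ) : ∀ x, ρ < x → f (x + n) = a ^ n * f x := by
  induction n with
  | zero => intro x _; simp
  | succ n ih =>
    intro x hx
    have : x + ((n + 1 : ℕ) : ℝ) = (x + n) + 1 := by push_cast; ring
    rw [this, h _ (by have : (0 : ℝ) ≤ n := n.cast_nonneg; linarith), ih x hx]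
    ring

/-- A decaying solution of an eventually periodic equation is a Floquet solution, with multiplier
`a` of modulus less than one; a suitable second solution has the multiplier `a⁻¹`. -/
theorem SolvesOn.exists_floquet {Q u u' v v' : ℝ → ℂ} {ρ : ℝ} (hu : SolvesOn (Ioi ρ) Q u u')
    (hv : SolvesOn (Ioi ρ) Q v v') (hQ : ∀ x, ρ < x → Q (x + 1) = Q x)
    (hw : ∀ x ∈ Ioi ρ, u x * v' x - u' x * v x = 1)
    (hlim : Tendsto u atTop (𝓝 0)) (hlim' : Tendsto u' atTop (𝓝 0)) :
    ∃ a s : ℂ, a ≠ 0 ∧ ‖a‖ < 1 ∧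
      (∀ x, ρ < x → u (x + 1) = a * u x ∧ u' (x + 1) = a * u' x) ∧
      (∀ x, ρ < x → v (x + 1) + s * u (x + 1) = a⁻¹ * (v x + s * u x) ∧
        v' (x + 1) + s * u' (x + 1) = a⁻¹ * (v' x + s * u' x)) := by
  obtain ⟨a, b, hab⟩ := hu.eq_combination hv (hu.shift_of_periodic hQ) hw isOpen_Ioi
    isPreconnected_Ioi
  obtain ⟨c, d, hcd⟩ := hu.eq_combination hv (hv.shift_of_periodic hQ) hw isOpen_Ioi
    isPreconnected_Ioi
  -- b is the Wronskian of u with its translate; it is constant and both factors decay.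
  have hb : b = 0 := by
    have hT : Tendsto (fun x : ℝ => x + 1) atTop atTop :=
      tendsto_atTop_add_const_right atTop (1 : ℝ) tendsto_id
    have h1 := (hlim.mul (hlim'.comp hT)).sub (hlim'.mul (hlim.comp hT))
    have h2 : Tendsto (fun _ : ℝ => b) atTop (𝓝 (0 * 0 - 0 * 0)) := by
      refine h1.congr' ?_
      filter_upwards [eventually_gt_atTop ρ] with x hx
      obtain ⟨e1, e2⟩ := hab x hx
      simp only [Function.comp]
      rw [e1, e2]
      linear_combination b * hw x hx
    simpa using tendsto_nhds_unique tendsto_const_nhds h2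
  subst hb
  have hu1 : ∀ x, ρ < x → u (x + 1) = a * u x ∧ u' (x + 1) = a * u' x := fun x hx => by
    simpa using hab x hx
  have hx0 : ρ < ρ + 1 := by linarith
  -- Translation is triangular in the basis u, v, and preserving the Wronskian means determinant
  -- one.
  have had : a * d = 1 := by
    have h1 := hw (ρ + 1 + 1) (show ρ < ρ + 1 + 1 by linarith)
    rw [(hu1 _ hx0).1, (hu1 _ hx0).2, (hcd _ hx0).1, (hcd _ hx0).2] at h1
    linear_combination h1 - a * d * hw _ hx0
  have ha0 : a ≠ 0 := left_ne_zero_of_mul_eq_one had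
  have ha1 : ‖a‖ < 1 := by
    have hT : Tendsto (fun n : ℕ => ρ + 1 + (n : ℝ)) atTop atTop :=
      tendsto_atTop_add_const_left _ _ tendsto_natCast_atTop_atTop
    -- If |a| ≥ 1, then |f(ρ + 1 + n)| ≥ |f(ρ + 1)| for f = u, u'; decay makes both vanish at ρ + 1,
    -- against Wronskian one.
    by_contra hge
    rw [not_lt] at hge
    have hz : ∀ f : ℝ → ℂ, Tendsto f atTop (𝓝 0) → (∀ x, ρ < x → f (x + 1) = a * f x) →
        f (ρ + 1) = 0 := by
      intro f hf hfa
      have h1 := (hf.comp hT).norm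
      rw [norm_zero] at h1
      have h2 : ‖f (ρ + 1)‖ ≤ 0 := by
        refine ge_of_tendsto h1 (Eventually.of_forall fun n => ?_)
        simp only [Function.comp]
        rw [iterate_shift hfa n _ hx0, norm_mul, norm_pow]
        exact le_mul_of_one_le_left (norm_nonneg _) (one_le_pow₀ hge)
      exact norm_le_zero_iff.1 h2
    have h3 := hw _ hx0
    rw [hz u hlim fun x hx => (hu1 x hx).1, hz u' hlim' fun x hx => (hu1 x hx).2] at h3
    simp at h3
  have hd : d = a⁻¹ := eq_inv_of_mul_eq_one_right had
  have hne : a⁻¹ - a ≠ 0 := by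
    intro h0
    have h1 : a * a = 1 := by
      rw [← hd] at h0
      linear_combination had - a * h0
    have h2 : ‖a‖ * ‖a‖ = 1 := by rw [← norm_mul, h1, norm_one]
    nlinarith [norm_nonneg a]
  -- s makes v + su the second eigenvector; a⁻¹ ≠ a because |a| < 1.
  refine ⟨a, c / (a⁻¹ - a), ha0, ha1, hu1, fun x hx => ?_⟩
  rw [(hu1 x hx).1, (hu1 x hx).2, (hcd x hx).1, (hcd x hx).2, hd]
  have hs : c + c / (a⁻¹ - a) * a = a⁻¹ * (c / (a⁻¹ - a)) := by
    linear_combination -(div_mul_cancel₀ c hne)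
  constructor
  · linear_combination u x * hs
  · linear_combination u' x * hs

/-- Every Floquet multiplier is bounded by the largest one. -/
theorem IsFloquetMultiplier.norm_le {W : ℝ → ℝ} {E ρ : ℝ} {μ a : ℂ}
    (hμ : IsFloquetMultiplier W E μ) {u u' w w' : ℝ → ℂ}
    (hu : SolvesOn (Ioi ρ) (fun x => (W x : ℂ) - E) u u')
    (hw : SolvesOn (Ioi ρ) (fun x => (W x : ℂ) - E) w w')
    (huw : ∀ x ∈ Ioi ρ, u x * w' x - u' x * w x = 1) (ha0 : a ≠ 0) (ha1 : ‖a‖ < 1)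
    (hua : ∀ x, ρ < x → u (x + 1) = a * u x ∧ u' (x + 1) = a * u' x)
    (hwa : ∀ x, ρ < x → w (x + 1) = a⁻¹ * w x ∧ w' (x + 1) = a⁻¹ * w' x) :
    ‖μ‖ ≤ ‖a⁻¹‖ := by
  obtain ⟨ψ, hψ0, hψ, hψμ⟩ := hμ
  have hinv : 1 ≤ ‖a⁻¹‖ := by
    rw [norm_inv]
    exact (one_le_inv₀ (norm_pos_iff.2 ha0)).2 ha1.le
  have hψμ' : ∀ x, deriv ψ (x + 1) = μ * deriv ψ x := fun x => by
    rw [← deriv_comp_add_const, ← deriv_const_mul _ (hψ.1 x)]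
    exact congrArg (fun f => deriv f x) (funext hψμ)
  obtain ⟨α, β, hαβ⟩ := hu.eq_combination hw (hψ.solvesOn _) huw isOpen_Ioi isPreconnected_Ioi
  have hx0 : ρ < ρ + 1 := by linarith
  have h1 := hψμ (ρ + 1)
  have h2 := hψμ' (ρ + 1)
  have hx1 : ρ < ρ + 1 + 1 := by linarith
  rw [(hαβ _ hx1).1, (hαβ _ hx0).1, (hua _ hx0).1, (hwa _ hx0).1] at h1
  rw [(hαβ _ hx1).2, (hαβ _ hx0).2, (hua _ hx0).2, (hwa _ hx0).2] at h2
  have hW := huw _ hx0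
  have e1 : α * (a - μ) = 0 := by
    linear_combination w' (ρ + 1) * h1 - w (ρ + 1) * h2 - α * (a - μ) * hW
  have e2 : β * (a⁻¹ - μ) = 0 := by
    linear_combination u (ρ + 1) * h2 - u' (ρ + 1) * h1 - β * (a⁻¹ - μ) * hW
  rcases mul_eq_zero.1 e1 with hα | hα
  · rcases mul_eq_zero.1 e2 with hβ | hβ
    · rcases eq_or_ne μ 0 with rfl | hμ0
      · simp
      exfalso
      apply hψ0
      funext x
      -- Now ψ vanishes beyond ρ, and ψ(x + n) = μⁿψ(x) with μ ≠ 0 carries the zero back to every x.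
      obtain ⟨n, hn⟩ := exists_nat_gt (ρ - x)
      have h3 := iterate_shift (ρ := x - 1) (fun y _ => hψμ y) n x (by linarith)
      rw [(hαβ (x + n) (show ρ < x + n by linarith)).1, hα, hβ] at h3
      simpa [hμ0] using h3.symm
    · rw [sub_eq_zero.1 hβ]
  · rw [← sub_eq_zero.1 hα]
    linarith

/-- A Floquet solution on a half line extends to the whole line. -/
theorem SolvesOn.isFloquetMultiplier {W : ℝ → ℝ} {E ρ : ℝ} {μ : ℂ} (hμ : μ ≠ 0)
    (hW : ∀ x, W (x + 1) = W x) {w w' : ℝ → ℂ}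
    (hw : SolvesOn (Ioi ρ) (fun x => (W x : ℂ) - E) w w')
    (hwμ : ∀ x, ρ < x → w (x + 1) = μ * w x) (hne : ∃ x, ρ < x ∧ w x ≠ 0) :
    IsFloquetMultiplier W E μ := by
  have hWn : ∀ (n : ℕ) (x : ℝ), W (x + n) = W x := by
    intro n x
    have := Function.Periodic.nat_mul (f := W) (c := 1) hW n x
    rwa [mul_one] at this
  let N : ℝ → ℕ := fun x => ⌈ρ - x⌉₊ + 1
  have hN : ∀ x, ρ < x + N x := fun x => by
    have := Nat.le_ceil (ρ - x)
    simp only [N]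
    push_cast
    linarith
  -- The integer-valued `N` jumps, so differentiability of the extension rests on this independence
  -- of the number of periods: near each point a fixed n may be used.
  have hcross : ∀ (m n : ℕ) (x : ℝ), ρ < x + m → ρ < x + n →
      μ⁻¹ ^ m * w (x + m) = μ⁻¹ ^ n * w (x + n) := by
    have aux : ∀ (m n : ℕ) (x : ℝ), m ≤ n → ρ < x + m →
        μ⁻¹ ^ m * w (x + m) = μ⁻¹ ^ n * w (x + n) := by
      intro m n x hmn hm
      obtain ⟨j, rfl⟩ := Nat.exists_eq_add_of_le hmn
      have : x + ((m + j : ℕ) : ℝ) = (x + m) + j := by push_cast; ring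
      rw [this, iterate_shift hwμ j _ hm, pow_add]
      have : μ⁻¹ ^ j * μ ^ j = 1 := by rw [← mul_pow, inv_mul_cancel₀ hμ, one_pow]
      linear_combination (-(μ⁻¹ ^ m * w (x + m))) * this
    intro m n x hm hn
    rcases le_total m n with h | h
    · exact aux m n x h hm
    · exact (aux n m x h hn).symm
  let ψ : ℝ → ℂ := fun x => μ⁻¹ ^ N x * w (x + N x)
  have hψ : ∀ (n : ℕ) (x : ℝ), ρ < x + n → ψ x = μ⁻¹ ^ n * w (x + n) :=
    fun n x hx => hcross _ _ _ (hN x) hx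
  have hloc : ∀ (n : ℕ) (x : ℝ), ρ < x + n →
      HasDerivAt ψ (μ⁻¹ ^ n * w' (x + n)) x := by
    intro n x hx
    have h1 := ((hw (x + n) hx).1.comp_add_const x n).const_mul (μ⁻¹ ^ n)
    refine h1.congr_of_eventuallyEq ?_
    filter_upwards [lt_mem_nhds (show ρ - n < x by linarith)] with y hy
    exact hψ n y (by linarith)
  have hloc' : ∀ (n : ℕ) (x : ℝ), ρ < x + n →
      HasDerivAt (deriv ψ) (μ⁻¹ ^ n * (((W (x + n) : ℂ) - E) * w (x + n))) x := by
    intro n x hx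
    have h1 := ((hw (x + n) hx).2.comp_add_const x n).const_mul (μ⁻¹ ^ n)
    refine h1.congr_of_eventuallyEq ?_
    filter_upwards [lt_mem_nhds (show ρ - n < x by linarith)] with y hy
    exact (hloc n y (by linarith)).deriv
  refine ⟨ψ, ?_, ⟨fun x => (hloc _ x (hN x)).differentiableAt,
    fun x => (hloc' _ x (hN x)).differentiableAt, fun x => ?_⟩, fun x => ?_⟩
  · obtain ⟨x, hx, hx0⟩ := hne
    intro h
    apply hx0
    have := hψ 0 x (by simpa using hx)
    rw [h] at this
    simpa using this.symm
  · rw [(hloc' _ x (hN x)).deriv, hWn, hψ _ x (hN x)]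
    ring
  · have h1 : ρ < x + ((N x + 1 : ℕ) : ℝ) := by
      have := hN x
      push_cast
      linarith
    have h2 : (x + 1) + (N x : ℝ) = x + ((N x + 1 : ℕ) : ℝ) := by push_cast; ring
    rw [hψ (N x) (x + 1) (by rw [h2]; exact h1), hψ (N x + 1) x h1, h2, pow_succ]
    linear_combination (-(μ⁻¹ ^ N x * w (x + ((N x + 1 : ℕ) : ℝ)))) * inv_mul_cancel₀ hμ

/-- Dividing |f| by exp(x log|a|) leaves a continuous function that is 1-periodic beyond ρ, hence
bounded for x ≥ 0. -/
theorem exists_exp_bound_of_shift {f : ℝ → ℂ} {ρ : ℝ} {a : ℂ} (hf : Continuous f) (ha : a ≠ 0)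
    (h : ∀ x, ρ < x → f (x + 1) = a * f x) :
    ∃ C, 0 < C ∧ ∀ x, 0 ≤ x → ‖f x‖ ≤ C * Real.exp (Real.log ‖a‖ * x) := by
  have ha' : 0 < ‖a‖ := norm_pos_iff.2 ha
  obtain ⟨C, hC0, hC⟩ := exists_bound_of_periodic_Ioi (ρ := ρ)
    (g := fun x => ‖f x‖ * Real.exp (-(Real.log ‖a‖ * x))) (by fun_prop) (fun x hx => by
      have : -(Real.log ‖a‖ * (x + 1)) = -(Real.log ‖a‖ * x) + -Real.log ‖a‖ := by ring
      rw [h x hx, norm_mul, this, Real.exp_add, Real.exp_neg (Real.log ‖a‖), Real.exp_log ha']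
      field_simp)
  refine ⟨C, hC0, fun x hx => ?_⟩
  have h1 := hC x hx
  rw [Real.exp_neg, ← div_eq_mul_inv, div_le_iff₀ (Real.exp_pos _)] at h1
  exact h1

/-! ### Dependence on the spectral parameter -/

/-- Carathéodory's form of the derivative: G is the difference quotient, so continuity of G at the
single point e suffices. -/
theorem hasDerivAt_add_sub_mul {F G : ℂ → ℂ} {c e : ℂ} (hF : ∀ z, F z = c + (z - e) * G z)
    (hG : ContinuousAt G e) : HasDerivAt F (G e) e := by
  rw [hasDerivAt_iff_tendsto_slope]
  refine (hG.tendsto.mono_left nhdsWithin_le_nhds).congr' ?_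
  filter_upwards [self_mem_nhdsWithin] with z hz
  have : z - e ≠ 0 := sub_ne_zero.2 hz
  rw [slope_def_field, hF z, hF e]
  field_simp
  ring

/-- A family of solutions of `f'' = (V - z) f` with common Cauchy data at the origin. -/
structure IsCauchyFamily (V : ℝ → ℂ) (U U' : ℂ → ℝ → ℂ) : Prop where
  solves : ∀ z, SolvesOn univ (fun x => V x - z) (U z) (U' z)
  value_zero : ∀ z w, U z 0 = U w 0
  deriv_zero : ∀ z w, U' z 0 = U' w 0

namespace IsCauchyFamily

variable {V : ℝ → ℂ} {U U' : ℂ → ℝ → ℂ} {e : ℂ} {v v' : ℝ → ℂ}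

theorem wronskian (hU : IsCauchyFamily V U U') (hv : SolvesOn univ (fun x => V x - e) v v')
    (hw : U e 0 * v' 0 - U' e 0 * v 0 = 1) (x : ℝ) : U e x * v' x - U' e x * v x = 1 := by
  rw [← hw]
  exact (hU.solves e).wronskian_eq hv isOpen_univ isPreconnected_univ trivial trivial

/-- Variation of constants in the spectral parameter. -/
theorem representation (hU : IsCauchyFamily V U U')
    (hv : SolvesOn univ (fun x => V x - e) v v') (hw : U e 0 * v' 0 - U' e 0 * v 0 = 1)
    (z : ℂ) (x : ℝ) :
    U z x = U e x + (z - e) * (U e x * (∫ y in (0 : ℝ)..x, U z y * v y)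
        - v x * ∫ y in (0 : ℝ)..x, U z y * U e y) ∧
    U' z x = U' e x + (z - e) * (U' e x * (∫ y in (0 : ℝ)..x, U z y * v y)
        - v' x * ∫ y in (0 : ℝ)..x, U z y * U e y) := by
  -- U_z = U_e W(U_z, v) - v W(U_z, U_e), and each Wronskian has derivative (z - e) times the
  -- product of its entries.
  have h1 := (hU.solves z).integral_wronskian hv (c := z - e) (fun x => by ring) x
  have h2 := (hU.solves z).integral_wronskian (hU.solves e) (c := z - e) (fun x => by ring) x
  rw [hU.value_zero z e, hU.deriv_zero z e] at h1 h2
  have h3 := hU.wronskian hv hw x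
  constructor
  · linear_combination (-U z x) * h3 + U e x * h1 - v x * h2 + U e x * hw
  · linear_combination (-U' z x) * h3 + U' e x * h1 - v' x * h2 + U' e x * hw

/-- The representation has U_z on both sides. For z near e, its integral term is at most half of
sup|U_z| and is absorbed, so sup|U_z| ≤ 2K; inserting this bound again gives the Lipschitz estimate.
-/
theorem exists_lipschitz (hU : IsCauchyFamily V U U')
    (hv : SolvesOn univ (fun x => V x - e) v v') (hw : U e 0 * v' 0 - U' e 0 * v 0 = 1)
    {M : ℝ} (hM : 0 ≤ M) :
    ∃ L, ∀ᶠ z in 𝓝 e, ∀ x ∈ Icc 0 M, ‖U z x - U e x‖ ≤ L * ‖z - e‖ := by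
  obtain ⟨K₁, hK₁⟩ := isCompact_Icc.exists_bound_of_continuousOn
    ((hU.solves e).continuous.continuousOn (s := Icc 0 M))
  obtain ⟨K₂, hK₂⟩ := isCompact_Icc.exists_bound_of_continuousOn
    (hv.continuous.continuousOn (s := Icc 0 M))
  set K := max (max K₁ K₂) 0 with hKdef
  have hK0 : 0 ≤ K := le_max_right _ _
  have hKu : ∀ x ∈ Icc 0 M, ‖U e x‖ ≤ K := fun x hx =>
    (hK₁ x hx).trans ((le_max_left _ _).trans (le_max_left _ _))
  have hKv : ∀ x ∈ Icc 0 M, ‖v x‖ ≤ K := fun x hx =>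
    (hK₂ x hx).trans ((le_max_right _ _).trans (le_max_left _ _))
  have hmain : ∀ (z : ℂ) (S : ℝ), 0 ≤ S → (∀ x ∈ Icc 0 M, ‖U z x‖ ≤ S) →
      ∀ x ∈ Icc 0 M, ‖U z x - U e x‖ ≤ ‖z - e‖ * (2 * K ^ 2 * M * S) := by
    intro z S hS hzS x hx
    have hbnd : ∀ g : ℝ → ℂ, (∀ x ∈ Icc 0 M, ‖g x‖ ≤ K) →
        ‖∫ y in (0 : ℝ)..x, U z y * g y‖ ≤ S * K * M := by
      intro g hg
      have h1 : ‖∫ y in (0 : ℝ)..x, U z y * g y‖ ≤ S * K * |x - 0| := by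
        refine intervalIntegral.norm_integral_le_of_norm_le_const fun y hy => ?_
        rw [uIoc_of_le hx.1] at hy
        have hy' : y ∈ Icc 0 M := ⟨hy.1.le, hy.2.trans hx.2⟩
        rw [norm_mul]
        exact mul_le_mul (hzS y hy') (hg y hy') (norm_nonneg _) hS
      rw [sub_zero, abs_of_nonneg hx.1] at h1
      exact h1.trans (mul_le_mul_of_nonneg_left hx.2 (mul_nonneg hS hK0))
    have hr := (hU.representation hv hw z x).1
    rw [sub_eq_iff_eq_add'.2 hr, norm_mul]
    refine mul_le_mul_of_nonneg_left ?_ (norm_nonneg _)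
    refine (norm_sub_le _ _).trans ?_
    rw [norm_mul, norm_mul]
    have h1 := mul_le_mul (hKu x hx) (hbnd v hKv) (norm_nonneg _) hK0
    have h2 := mul_le_mul (hKv x hx) (hbnd (U e) hKu) (norm_nonneg _) hK0
    calc _ ≤ _ := add_le_add h1 h2
      _ = _ := by ring
  refine ⟨2 * K ^ 2 * M * (2 * K), ?_⟩
  have hsmall : ∀ᶠ z in 𝓝 e, ‖z - e‖ * (2 * K ^ 2 * M) < 1 / 2 := by
    have hc : Continuous fun z : ℂ => ‖z - e‖ * (2 * K ^ 2 * M) := by fun_prop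
    exact hc.continuousAt.eventually (gt_mem_nhds (by simp))
  filter_upwards [hsmall] with z hz x hx
  obtain ⟨x₀, hx₀, hmax⟩ := isCompact_Icc.exists_isMaxOn (nonempty_Icc.2 hM)
    ((hU.solves z).continuous.norm.continuousOn (s := Icc 0 M))
  have hS : ∀ x ∈ Icc 0 M, ‖U z x‖ ≤ ‖U z x₀‖ := fun x hx => hmax hx
  have h2 := hmain z _ (norm_nonneg _) hS x₀ hx₀
  have h3 := norm_sub_norm_le (U z x₀) (U e x₀)
  have h4 := hKu x₀ hx₀
  have h5 := mul_le_mul_of_nonneg_right hz.le (norm_nonneg (U z x₀))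
  have h6 : ‖U z x₀‖ ≤ 2 * K := by nlinarith
  have h7 := hmain z (2 * K) (by positivity) (fun x hx => (hS x hx).trans h6) x hx
  linarith

theorem continuousAt_integral (hU : IsCauchyFamily V U U')
    (hv : SolvesOn univ (fun x => V x - e) v v') (hw : U e 0 * v' 0 - U' e 0 * v 0 = 1)
    {M : ℝ} (hM : 0 ≤ M) {g : ℝ → ℂ} (hg : Continuous g) :
    ContinuousAt (fun z => ∫ y in (0 : ℝ)..M, U z y * g y) e := by
  obtain ⟨L, hL⟩ := hU.exists_lipschitz hv hw hM
  obtain ⟨K, hK⟩ := isCompact_Icc.exists_bound_of_continuousOn (hg.continuousOn (s := Icc 0 M))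
  rw [ContinuousAt, tendsto_iff_norm_sub_tendsto_zero]
  have hlim : Tendsto (fun z : ℂ => L * ‖z - e‖ * K * M) (𝓝 e) (𝓝 0) := by
    have hc : Continuous fun z : ℂ => L * ‖z - e‖ * K * M := by fun_prop
    simpa using hc.tendsto e
  refine squeeze_zero' (Eventually.of_forall fun z => norm_nonneg _) ?_ hlim
  filter_upwards [hL] with z hz
  have hi : ∀ z, IntervalIntegrable (fun y => U z y * g y) MeasureTheory.volume 0 M := fun z =>
    ((hU.solves z).continuous.mul hg).intervalIntegrable _ _
  rw [← intervalIntegral.integral_sub (hi z) (hi e)]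
  have h1 : ‖∫ y in (0 : ℝ)..M, U z y * g y - U e y * g y‖ ≤ L * ‖z - e‖ * K * |M - 0| := by
    refine intervalIntegral.norm_integral_le_of_norm_le_const fun y hy => ?_
    rw [uIoc_of_le hM] at hy
    have hy' := Ioc_subset_Icc_self hy
    rw [← sub_mul, norm_mul]
    exact mul_le_mul (hz y hy') (hK y hy') (norm_nonneg _) ((norm_nonneg _).trans (hz y hy'))
  rwa [sub_zero, abs_of_nonneg hM] at h1

/-- Differentiability of the solutions in the spectral parameter. -/
theorem hasDerivAt (hU : IsCauchyFamily V U U')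
    (hv : SolvesOn univ (fun x => V x - e) v v') (hw : U e 0 * v' 0 - U' e 0 * v 0 = 1)
    {M : ℝ} (hM : 0 ≤ M) :
    HasDerivAt (fun z => U z M) (U e M * (∫ y in (0 : ℝ)..M, U e y * v y)
        - v M * ∫ y in (0 : ℝ)..M, U e y * U e y) e ∧
    HasDerivAt (fun z => U' z M) (U' e M * (∫ y in (0 : ℝ)..M, U e y * v y)
        - v' M * ∫ y in (0 : ℝ)..M, U e y * U e y) e := by
  have h1 := hU.continuousAt_integral hv hw hM hv.continuous
  have h2 := hU.continuousAt_integral hv hw hM (hU.solves e).continuous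
  exact ⟨hasDerivAt_add_sub_mul (fun z => (hU.representation hv hw z M).1)
      ((continuousAt_const.mul h1).sub (continuousAt_const.mul h2)),
    hasDerivAt_add_sub_mul (fun z => (hU.representation hv hw z M).2)
      ((continuousAt_const.mul h1).sub (continuousAt_const.mul h2))⟩

end IsCauchyFamily

/-! ### Reality and parity -/

theorem SolvesOn.conj_eq_self {Q f f' : ℝ → ℂ} (hQ : Continuous Q)
    (hQr : ∀ x, starRingEnd ℂ (Q x) = Q x) (h : SolvesOn univ Q f f')
    (h0 : starRingEnd ℂ (f 0) = f 0) (h0' : starRingEnd ℂ (f' 0) = f' 0) :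
    (∀ x, starRingEnd ℂ (f x) = f x) ∧ ∀ x, starRingEnd ℂ (f' x) = f' x := by
  have hd := (h.conj fun x _ => hQr x).sub h
  have hz := hd.eq_zero hQ (by simp [h0]) (by simp [h0'])
  refine ⟨fun x => sub_eq_zero.1 (hz x), fun x => sub_eq_zero.1 ?_⟩
  have h1 := (hd x trivial).1
  have h2 : (fun x => starRingEnd ℂ (f x) - f x) = fun _ => (0 : ℂ) := funext hz
  rw [h2] at h1
  exact h1.unique (hasDerivAt_const x 0)

/-- For an even, bounded potential a bound state is even or odd, and its non-trivial Cauchy datum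
at the origin is nonzero. -/
theorem IsBoundState.even_or_odd {V : ℝ → ℝ} {E K : ℝ} {Φ : ℝ → ℂ} (hΦ : IsBoundState V E Φ)
    (hV : Continuous V) (heven : ∀ x, V (-x) = V x)
    (hK : ∀ x, 0 < x → ‖(V x : ℂ) - E‖ ≤ K) :
    (Function.Even Φ ∧ Φ 0 ≠ 0 ∧ deriv Φ 0 = 0) ∨ (Function.Odd Φ ∧ Φ 0 = 0 ∧ deriv Φ 0 ≠ 0) := by
  obtain ⟨hne, hL2, hsol⟩ := hΦ
  have hQ : Continuous fun x => (V x : ℂ) - E := by fun_prop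
  have hS := hsol.solvesOn univ
  have hR := hS.comp_neg (fun x => by simp [heven])
  have hL2' : MeasureTheory.MemLp (fun x => Φ (-x)) 2 MeasureTheory.volume :=
    hL2.comp_measurePreserving (MeasureTheory.Measure.measurePreserving_neg _)
  obtain ⟨a1, a2⟩ := (hS.mono (subset_univ (Ioi 0))).tendsto_zero hQ.continuousOn hK hL2
  obtain ⟨b1, b2⟩ := (hR.mono (subset_univ (Ioi 0))).tendsto_zero hQ.continuousOn hK hL2'
  -- The reflected bound state decays as well, so its constant Wronskian with Φ is zero; at the
  -- origin it equals -2Φ(0)Φ'(0).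
  have hW : Φ 0 * -deriv Φ (-0) - deriv Φ 0 * Φ (-0) = 0 := by
    have h1 := (a1.mul b2).sub (a2.mul b1)
    have h2 : Tendsto (fun _ : ℝ => Φ 0 * -deriv Φ (-0) - deriv Φ 0 * Φ (-0)) atTop
        (𝓝 (0 * 0 - 0 * 0)) :=
      h1.congr fun x => hS.wronskian_eq hR isOpen_univ isPreconnected_univ trivial trivial
    simpa using tendsto_nhds_unique tendsto_const_nhds h2
  rw [neg_zero] at hW
  have hprod : Φ 0 * deriv Φ 0 = 0 := by linear_combination (-1 / 2 : ℂ) * hW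
  have hnz : ¬(Φ 0 = 0 ∧ deriv Φ 0 = 0) := fun h => hne (funext (hS.eq_zero hQ h.1 h.2))
  rcases mul_eq_zero.1 hprod with h | h
  · refine Or.inr ⟨fun x => ?_, h, fun h' => hnz ⟨h, h'⟩⟩
    have := (hR.add hS).eq_zero hQ (by simp [h]) (by simp) x
    exact eq_neg_of_add_eq_zero_left this
  · refine Or.inl ⟨fun x => ?_, fun h' => hnz ⟨h', h⟩, h⟩
    exact sub_eq_zero.1 ((hR.sub hS).eq_zero hQ (by simp) (by simp [h]) x)

/-! ### Expansion of the quotient Θ/Θ' -/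

/-- For real f the integral of f² is nondecreasing in M, so its value at M = 1 is a uniform lower
bound. -/
theorem exists_pos_le_norm_integral_sq {f : ℝ → ℂ} (hf : Continuous f)
    (hreal : ∀ x, starRingEnd ℂ (f x) = f x) (hne : ∃ x ∈ Icc (0 : ℝ) 1, f x ≠ 0) :
    ∃ A, 0 < A ∧ ∀ M, 1 ≤ M → A ≤ ‖∫ y in (0 : ℝ)..M, f y ^ 2‖ := by
  have hfr : ∀ x, ((f x).re : ℂ) = f x := fun x => Complex.conj_eq_iff_re.1 (hreal x)
  have hc : Continuous fun x => (f x).re ^ 2 := (Complex.continuous_re.comp hf).pow 2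
  refine ⟨∫ y in (0 : ℝ)..1, (f y).re ^ 2, ?_, fun M hM => ?_⟩
  · obtain ⟨x, hx, hx0⟩ := hne
    refine intervalIntegral.integral_pos one_pos hc.continuousOn (fun y _ => sq_nonneg _)
      ⟨x, hx, ?_⟩
    have : (f x).re ≠ 0 := fun h => hx0 (by rw [← hfr x, h, Complex.ofReal_zero])
    positivity
  · have h1 : ∫ y in (0 : ℝ)..M, f y ^ 2 = ((∫ y in (0 : ℝ)..M, (f y).re ^ 2 : ℝ) : ℂ) := by
      rw [← intervalIntegral.integral_ofReal]
      refine intervalIntegral.integral_congr fun y _ => ?_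
      simp only [Complex.ofReal_pow, hfr]
    rw [h1, Complex.norm_real]
    refine le_trans ?_ (le_abs_self _)
    exact intervalIntegral.integral_mono_interval le_rfl zero_le_one hM
      (Eventually.of_forall fun y => sq_nonneg _) (hc.intervalIntegrable _ _)

theorem norm_div_add_div_le {p r D : ℂ} (hD : D ≠ 0) (hr : ‖r‖ ≤ ‖D‖ / 2) :
    -D + r ≠ 0 ∧ ‖p / (-D + r) + p / D‖ ≤ 2 * ‖p‖ * ‖r‖ / ‖D‖ ^ 2 := by
  have hDn : 0 < ‖D‖ := norm_pos_iff.2 hD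
  have h1 : ‖D‖ / 2 ≤ ‖-D + r‖ := by
    have := norm_sub_norm_le (-D) (-r)
    rw [norm_neg, norm_neg, sub_neg_eq_add] at this
    linarith
  have hne : -D + r ≠ 0 := norm_pos_iff.1 (by linarith)
  refine ⟨hne, ?_⟩
  have h2 : p / (-D + r) + p / D = p * r / ((-D + r) * D) := by
    field_simp
    ring
  rw [h2, norm_div, norm_mul, norm_mul, div_le_div_iff₀ (by positivity) (by positivity)]
  have h3 := mul_le_mul_of_nonneg_left h1 (show 0 ≤ 2 * (‖p‖ * ‖r‖) * ‖D‖ by positivity)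
  nlinarith

theorem ofReal_cpow_half {E : ℝ} (hE : 0 ≤ E) :
    (E : ℂ) ^ (1 / 2 : ℂ) = (Real.sqrt E : ℂ) := by
  rw [Real.sqrt_eq_rpow, Complex.ofReal_cpow hE]
  norm_num

/-- If `v` and `v'` are real numbers, both are controlled by `v' - i √E v`. -/
theorem norm_le_norm_sub_I_mul {E : ℝ} (hE : 0 < E) {v v' : ℂ} (hv : starRingEnd ℂ v = v)
    (hv' : starRingEnd ℂ v' = v') :
    ‖v'‖ ≤ ‖v' - Complex.I * Real.sqrt E * v‖ ∧
      ‖v‖ ≤ ‖v' - Complex.I * Real.sqrt E * v‖ / Real.sqrt E := by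
  have hs : 0 < Real.sqrt E := Real.sqrt_pos.2 hE
  obtain ⟨x, rfl⟩ := Complex.conj_eq_iff_real.1 hv
  obtain ⟨y, rfl⟩ := Complex.conj_eq_iff_real.1 hv'
  constructor
  · have h := Complex.abs_re_le_norm ((y : ℂ) - Complex.I * Real.sqrt E * x)
    simpa using h
  · have h := Complex.abs_im_le_norm ((y : ℂ) - Complex.I * Real.sqrt E * x)
    rw [le_div_iff₀ hs]
    have h2 : ((y : ℂ) - Complex.I * Real.sqrt E * x).im = -(Real.sqrt E * x) := by simp
    rw [h2, abs_neg, abs_mul, abs_of_pos hs] at h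
    rw [Complex.norm_real, Real.norm_eq_abs]
    linarith

/-- The expansion of `Θ / Θ'` for a family of solutions whose member at energy `E` decays
exponentially, given exponential bounds on a second solution. -/
theorem exists_expansion {V : ℝ → ℂ} {u : ℂ → ℝ → ℂ} {v : ℝ → ℂ} {E k ρ C₁ C₂ C₃ : ℝ}
    (hE : 0 < E) (hk : 0 < k) (hU : IsCauchyFamily V u (fun z => deriv (u z)))
    (hv : SolvesOn univ (fun x => V x - E) v (deriv v))
    (hw : u E 0 * deriv v 0 - deriv (u E) 0 * v 0 = 1)
    (hur : ∀ x, starRingEnd ℂ (u E x) = u E x)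
    (hvr : ∀ x, starRingEnd ℂ (v x) = v x)
    (hvr' : ∀ x, starRingEnd ℂ (deriv v x) = deriv v x)
    (hC₁ : 0 < C₁) (hC₂ : 0 < C₂) (hC₃ : 0 < C₃)
    (hu₁ : ∀ x, 0 ≤ x → ‖u E x‖ ≤ C₁ * Real.exp (-k * x))
    (hu₂ : ∀ x, 0 ≤ x → ‖deriv (u E) x‖ ≤ C₂ * Real.exp (-k * x))
    (hv₁ : ∀ x, 0 ≤ x → ‖v x‖ ≤ C₃ * Real.exp (k * x)) :
    ∃ C M₀ : ℝ, ρ < M₀ ∧ ∀ M : ℝ, M₀ ≤ M →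
      DifferentiableAt ℂ (Theta u M) (E : ℂ) ∧
      deriv (Theta u M) (E : ℂ) ≠ 0 ∧
      (deriv v M ^ 2 + (E : ℂ) * v M ^ 2) * (∫ y in (0 : ℝ)..M, u E y ^ 2) ≠ 0 ∧
      ‖Theta u M (E : ℂ) / deriv (Theta u M) (E : ℂ) -
        (Complex.I * (Real.sqrt E : ℂ)
            - (deriv (u E) M * deriv v M + (E : ℂ) * u E M * v M)) /
          ((deriv v M ^ 2 + (E : ℂ) * v M ^ 2) * ∫ y in (0 : ℝ)..M, u E y ^ 2)‖
        ≤ C * (M * Real.exp (-4 * k * M)) := by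
  have hW : ∀ x, u E x * deriv v x - deriv (u E) x * v x = 1 := hU.wronskian hv hw
  have huc : Continuous (u E) := (hU.solves E).continuous
  have hs : 0 < Real.sqrt E := Real.sqrt_pos.2 hE
  have hsE : (Real.sqrt E : ℂ) ^ 2 = E := by
    rw [← Complex.ofReal_pow, Real.sq_sqrt hE.le]
  obtain ⟨A₀, hA₀, hA⟩ := exists_pos_le_norm_integral_sq huc hur (by
    by_contra! h
    have h1 : deriv (u E) (1 / 2) = 0 := by
      have h2 : u E =ᶠ[𝓝 (1 / 2)] fun _ => 0 := by
        filter_upwards [Icc_mem_nhds (show (0 : ℝ) < 1 / 2 by norm_num)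
          (show (1 / 2 : ℝ) < 1 by norm_num)] with x hx
        exact h x hx
      rw [h2.deriv_eq, deriv_const]
    have h3 := hW (1 / 2)
    rw [h1, h (1 / 2) ⟨by norm_num, by norm_num⟩] at h3
    simp at h3)
  obtain ⟨c₀, hc₀⟩ : ∃ c₀ : ℂ, HasDerivAt (fun z : ℂ => z ^ (1 / 2 : ℂ)) c₀ E :=
    ⟨_, (hasDerivAt_id (E : ℂ)).cpow_const (Or.inl (by simpa using hE))⟩
  -- The constants are chosen so that |p| ≤ P e^{-kM}, |q| ≥ e^{kM}/D and |r| ≤ R M e^{-kM}.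
  set P := C₂ + Real.sqrt E * C₁ with hP
  set D := C₁ + C₂ / Real.sqrt E with hD
  set R := P * (C₁ * C₃) + ‖c₀‖ * C₁ with hR
  have hP0 : 0 < P := by positivity
  have hD0 : 0 < D := by positivity
  have hR0 : 0 < R := by positivity
  -- This makes |r| small compared with |qA| ≥ (A₀/D) e^{kM}, so Θ'(E) = -qA + r stays away from
  -- zero.
  have hlim : Tendsto (fun M : ℝ => R * (M * Real.exp (-(2 * k) * M))) atTop (𝓝 0) := by
    have h1 := (Real.tendsto_pow_mul_exp_neg_atTop_nhds_zero 1).comp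
      (tendsto_id.const_mul_atTop (show 0 < 2 * k by positivity))
    have h2 := h1.const_mul (R / (2 * k))
    rw [mul_zero] at h2
    refine h2.congr fun M => ?_
    simp only [Function.comp, id, pow_one, neg_mul]
    field_simp
  obtain ⟨M₁, hM₁⟩ := eventually_atTop.1
    (hlim.eventually (gt_mem_nhds (show 0 < A₀ / D / 2 by positivity)))
  refine ⟨2 * P * R / (A₀ / D) ^ 2, max (max M₁ 1) (ρ + 1),
    lt_of_lt_of_le (by linarith) (le_max_right _ _), fun M hM => ?_⟩
  have hM1 : 1 ≤ M := (le_max_right _ _).trans ((le_max_left _ _).trans hM)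
  have hMM : M₁ ≤ M := (le_max_left _ _).trans ((le_max_left _ _).trans hM)
  have hM0 : 0 ≤ M := zero_le_one.trans hM1
  obtain ⟨hd, hd'⟩ := hU.hasDerivAt hv hw hM0
  set A := ∫ y in (0 : ℝ)..M, u E y ^ 2 with hAdef
  set B := ∫ y in (0 : ℝ)..M, u E y * v y with hBdef
  have hAA : ∫ y in (0 : ℝ)..M, u E y * u E y = A := by simp only [hAdef, pow_two]
  rw [hAA] at hd hd'
  set p := deriv (u E) M - Complex.I * Real.sqrt E * u E M with hp
  set q := deriv v M - Complex.I * Real.sqrt E * v M with hq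
  set r := p * B - Complex.I * c₀ * u E M with hr
  have hΘ : Theta u M E = p := by rw [Theta, ofReal_cpow_half hE.le]
  have hΘ' : HasDerivAt (Theta u M) (-(q * A) + r) E := by
    refine (hd'.sub ((hc₀.const_mul Complex.I).mul hd)).congr_deriv ?_
    rw [ofReal_cpow_half hE.le, hr, hp, hq]
    ring
  -- Growth of q is forced by 1 = uv' - u'v: u and u' are of size e^{-kM}, while |v'| and √E|v| are
  -- at most |q|.
  have hqexp : Real.exp (k * M) / D ≤ ‖q‖ := by
    obtain ⟨h1, h2⟩ := norm_le_norm_sub_I_mul hE (hvr M) (hvr' M)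
    rw [← hq] at h1 h2
    have h3 : (1 : ℝ) ≤ D * Real.exp (-k * M) * ‖q‖ := by
      calc (1 : ℝ) = ‖u E M * deriv v M - deriv (u E) M * v M‖ := by rw [hW M, norm_one]
        _ ≤ ‖u E M‖ * ‖deriv v M‖ + ‖deriv (u E) M‖ * ‖v M‖ := by
          rw [← norm_mul, ← norm_mul]; exact norm_sub_le _ _
        _ ≤ C₁ * Real.exp (-k * M) * ‖q‖ + C₂ * Real.exp (-k * M) * (‖q‖ / Real.sqrt E) := by
          refine add_le_add (mul_le_mul (hu₁ M hM0) h1 (norm_nonneg _) (by positivity))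
            (mul_le_mul (hu₂ M hM0) h2 (norm_nonneg _) (by positivity))
        _ = D * Real.exp (-k * M) * ‖q‖ := by rw [hD]; ring
    rw [div_le_iff₀ hD0]
    have h4 : Real.exp (k * M) * Real.exp (-k * M) = 1 := by
      rw [← Real.exp_add]; simp
    calc Real.exp (k * M) = Real.exp (k * M) * 1 := by ring
      _ ≤ Real.exp (k * M) * (D * Real.exp (-k * M) * ‖q‖) :=
        mul_le_mul_of_nonneg_left h3 (Real.exp_pos _).le
      _ = (Real.exp (k * M) * Real.exp (-k * M)) * (‖q‖ * D) := by ring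
      _ = ‖q‖ * D := by rw [h4, one_mul]
  have hqA : A₀ / D * Real.exp (k * M) ≤ ‖q * A‖ := by
    rw [norm_mul]
    calc A₀ / D * Real.exp (k * M) = Real.exp (k * M) / D * A₀ := by ring
      _ ≤ ‖q‖ * ‖A‖ := mul_le_mul hqexp (hA M hM1) hA₀.le (norm_nonneg _)
  have hqA0 : q * A ≠ 0 := norm_pos_iff.1 (lt_of_lt_of_le (by positivity) hqA)
  have hpn : ‖p‖ ≤ P * Real.exp (-k * M) := by
    calc ‖p‖ ≤ ‖deriv (u E) M‖ + ‖Complex.I * Real.sqrt E * u E M‖ := norm_sub_le _ _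
      _ = ‖deriv (u E) M‖ + Real.sqrt E * ‖u E M‖ := by
        rw [norm_mul, norm_mul, Complex.norm_I, one_mul, Complex.norm_real, Real.norm_eq_abs,
          abs_of_pos hs]
      _ ≤ C₂ * Real.exp (-k * M) + Real.sqrt E * (C₁ * Real.exp (-k * M)) :=
        add_le_add (hu₂ M hM0) (mul_le_mul_of_nonneg_left (hu₁ M hM0) hs.le)
      _ = P * Real.exp (-k * M) := by rw [hP]; ring
  have hBn : ‖B‖ ≤ C₁ * C₃ * M := by
    have h1 : ‖B‖ ≤ C₁ * C₃ * |M - 0| := by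
      refine intervalIntegral.norm_integral_le_of_norm_le_const fun y hy => ?_
      rw [uIoc_of_le hM0] at hy
      have h4 : Real.exp (-k * y) * Real.exp (k * y) = 1 := by
        rw [← Real.exp_add]; simp
      calc ‖u E y * v y‖ ≤ (C₁ * Real.exp (-k * y)) * (C₃ * Real.exp (k * y)) := by
            rw [norm_mul]
            exact mul_le_mul (hu₁ y hy.1.le) (hv₁ y hy.1.le) (norm_nonneg _) (by positivity)
        _ = C₁ * C₃ * (Real.exp (-k * y) * Real.exp (k * y)) := by ring
        _ = C₁ * C₃ := by rw [h4, mul_one]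
    rwa [sub_zero, abs_of_nonneg hM0] at h1
  have hrn : ‖r‖ ≤ R * (M * Real.exp (-k * M)) := by
    calc ‖r‖ ≤ ‖p * B‖ + ‖Complex.I * c₀ * u E M‖ := norm_sub_le _ _
      _ = ‖p‖ * ‖B‖ + ‖c₀‖ * ‖u E M‖ := by
        rw [norm_mul, norm_mul, norm_mul, Complex.norm_I, one_mul]
      _ ≤ P * Real.exp (-k * M) * (C₁ * C₃ * M) + ‖c₀‖ * (C₁ * Real.exp (-k * M)) * M := by
        refine add_le_add (mul_le_mul hpn hBn (norm_nonneg _) (by positivity)) ?_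
        refine (mul_le_mul_of_nonneg_left (hu₁ M hM0) (norm_nonneg _)).trans ?_
        -- M ≥ 1 lets the second term share the factor M that B brings to the first.
        exact le_mul_of_one_le_right (by positivity) hM1
      _ = R * (M * Real.exp (-k * M)) := by rw [hR]; ring
  have hrhalf : ‖r‖ ≤ ‖q * A‖ / 2 := by
    have h1 := hM₁ M hMM
    have h2 : Real.exp (-k * M) = Real.exp (-(2 * k) * M) * Real.exp (k * M) := by
      rw [← Real.exp_add]; congr 1; ring
    rw [h2] at hrn
    have h3 := mul_le_mul_of_nonneg_right h1.le (Real.exp_pos (k * M)).le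
    linarith
  obtain ⟨hne, hfin⟩ := norm_div_add_div_le (p := p) hqA0 hrhalf
  have hfac : deriv v M ^ 2 + (E : ℂ) * v M ^ 2
      = q * (deriv v M + Complex.I * Real.sqrt E * v M) := by
    rw [hq, ← hsE]
    linear_combination ((Real.sqrt E : ℂ) ^ 2 * v M ^ 2) * Complex.I_sq
  have hconj : deriv v M + Complex.I * Real.sqrt E * v M = starRingEnd ℂ q := by
    rw [hq]
    simp [hvr, hvr']
  have hqc : starRingEnd ℂ q ≠ 0 := by
    simpa using left_ne_zero_of_mul hqA0
  have hden : (deriv v M ^ 2 + (E : ℂ) * v M ^ 2) * A ≠ 0 := by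
    rw [hfac, hconj]
    exact mul_ne_zero (mul_ne_zero (left_ne_zero_of_mul hqA0) hqc) (right_ne_zero_of_mul hqA0)
  refine ⟨hΘ'.differentiableAt, by rwa [hΘ'.deriv], hden, ?_⟩
  have hcorr : (Complex.I * (Real.sqrt E : ℂ)
        - (deriv (u E) M * deriv v M + (E : ℂ) * u E M * v M)) /
      ((deriv v M ^ 2 + (E : ℂ) * v M ^ 2) * A) = -(p / (q * A)) := by
    have hnum : Complex.I * (Real.sqrt E : ℂ)
        - (deriv (u E) M * deriv v M + (E : ℂ) * u E M * v M)
        = -p * (deriv v M + Complex.I * Real.sqrt E * v M) := by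
      rw [hp]
      linear_combination (-Complex.I * (Real.sqrt E : ℂ)) * hW M
        - (Real.sqrt E : ℂ) ^ 2 * u E M * v M * Complex.I_sq
        + u E M * v M * hsE
    rw [hnum, hfac, ← neg_div, mul_right_comm q, hconj]
    exact mul_div_mul_right _ _ hqc
  rw [hΘ, hΘ'.deriv, hcorr, sub_neg_eq_add]
  refine hfin.trans ?_
  -- |p||r| contributes e^{-2kM} and |qA|² in the denominator another e^{-2kM}.
  have hexp : Real.exp (-k * M) * Real.exp (-k * M)
      = Real.exp (-4 * k * M) * Real.exp (k * M) ^ 2 := by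
    rw [← Real.exp_nat_mul, ← Real.exp_add, ← Real.exp_add]
    congr 1
    push_cast
    ring
  rw [div_le_iff₀ (by have := norm_pos_iff.2 hqA0; positivity)]
  calc 2 * ‖p‖ * ‖r‖ ≤ 2 * (P * Real.exp (-k * M)) * (R * (M * Real.exp (-k * M))) :=
        mul_le_mul (mul_le_mul_of_nonneg_left hpn zero_le_two) hrn (norm_nonneg _) (by positivity)
    _ = 2 * P * R * M * (Real.exp (-k * M) * Real.exp (-k * M)) := by ring
    _ = 2 * P * R / (A₀ / D) ^ 2 * (M * Real.exp (-4 * k * M))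
        * (A₀ / D * Real.exp (k * M)) ^ 2 := by
      rw [hexp]
      field_simp
    _ ≤ _ := mul_le_mul_of_nonneg_left (pow_le_pow_left₀ (by positivity) hqA 2) (by positivity)

/-! ### Normalized pair and conclusion -/

/-- The parity-independent properties of the normalized pair: common real Cauchy data, unit
Wronskian, and decay of `u E`. -/
theorem IsNormalizedPair.exists_common {V : ℝ → ℝ} {E K : ℝ} {Φ : ℝ → ℂ} {u v : ℂ → ℝ → ℂ}
    (huv : IsNormalizedPair V Φ u v) (hΦ : IsBoundState V E Φ) (hV : Continuous V)
    (heven : ∀ x, V (-x) = V x) (hK : ∀ x, 0 < x → ‖(V x : ℂ) - E‖ ≤ K) :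
    IsCauchyFamily (fun x => (V x : ℂ)) u (fun z => deriv (u z)) ∧
      IsSchrodingerSolution V E (v E) ∧
      u E 0 * deriv (v E) 0 - deriv (u E) 0 * v E 0 = 1 ∧
      (∀ x, starRingEnd ℂ (u E x) = u E x) ∧
      (∀ x, starRingEnd ℂ (v E x) = v E x) ∧
      (∀ x, starRingEnd ℂ (deriv (v E) x) = deriv (v E) x) ∧
      Tendsto (u E) atTop (𝓝 0) ∧ Tendsto (deriv (u E)) atTop (𝓝 0) := by
  have hQ : Continuous fun x => (V x : ℂ) - E := by fun_prop
  have hQr : ∀ x, starRingEnd ℂ ((V x : ℂ) - E) = (V x : ℂ) - E := fun x => by simp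
  -- u_E inherits square integrability from Φ; the factor c will be 1/Φ(0) in the even case and
  -- 1/Φ'(0) in the odd one.
  have hL2 : ∀ c : ℂ, (∀ x, u E x = c * Φ x) → SolvesOn univ (fun x => (V x : ℂ) - E) (u E)
      (deriv (u E)) → Tendsto (u E) atTop (𝓝 0) ∧ Tendsto (deriv (u E)) atTop (𝓝 0) := by
    intro c hc hu
    refine (hu.mono (subset_univ (Ioi 0))).tendsto_zero hQ.continuousOn hK ?_
    have := hΦ.2.1.const_mul c
    rwa [← (funext hc : u E = fun x => c * Φ x)] at this
  have hΦs := hΦ.2.2.solvesOn univ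
  rcases hΦ.even_or_odd hV heven hK with ⟨hpar, h0, h0'⟩ | ⟨hpar, h0, h0'⟩
  · have h := huv.1 hpar
    have hu := (h E).1.1.solvesOn univ
    have hv := (h E).2.1.solvesOn univ
    obtain ⟨r1, -⟩ := hu.conj_eq_self hQ hQr (by simp [(h E).1.2.1]) (by simp [(h E).1.2.2])
    obtain ⟨r2, r3⟩ := hv.conj_eq_self hQ hQr (by simp [(h E).2.2.1]) (by simp [(h E).2.2.2])
    refine ⟨⟨fun z => (h z).1.1.solvesOn univ, fun z w => by rw [(h z).1.2.1, (h w).1.2.1],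
      fun z w => by rw [(h z).1.2.2, (h w).1.2.2]⟩, (h E).2.1, ?_, r1, r2, r3,
      hL2 (Φ 0)⁻¹ (fun x => sub_eq_zero.1 ((hu.sub (hΦs.const_mul (Φ 0)⁻¹)).eq_zero hQ ?_ ?_ x))
        hu⟩
    · rw [(h E).1.2.1, (h E).1.2.2, (h E).2.2.1, (h E).2.2.2]; ring
    · rw [(h E).1.2.1, inv_mul_cancel₀ h0, sub_self]
    · rw [(h E).1.2.2, h0', mul_zero, sub_self]
  · have h := huv.2 hpar
    have hu := (h E).1.1.solvesOn univ
    have hv := (h E).2.1.solvesOn univ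
    obtain ⟨r1, -⟩ := hu.conj_eq_self hQ hQr (by simp [(h E).1.2.1]) (by simp [(h E).1.2.2])
    obtain ⟨r2, r3⟩ := hv.conj_eq_self hQ hQr (by simp [(h E).2.2.1]) (by simp [(h E).2.2.2])
    refine ⟨⟨fun z => (h z).1.1.solvesOn univ, fun z w => by rw [(h z).1.2.1, (h w).1.2.1],
      fun z w => by rw [(h z).1.2.2, (h w).1.2.2]⟩, (h E).2.1, ?_, r1, r2, r3,
      hL2 (deriv Φ 0)⁻¹
        (fun x => sub_eq_zero.1 ((hu.sub (hΦs.const_mul (deriv Φ 0)⁻¹)).eq_zero hQ ?_ ?_ x)) hu⟩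
    · rw [(h E).1.2.1, (h E).1.2.2, (h E).2.2.1, (h E).2.2.2]; ring
    · rw [(h E).1.2.1, h0, mul_zero, sub_self]
    · rw [(h E).1.2.2, inv_mul_cancel₀ h0', sub_self]

theorem mainTheorem2
    (V Vper Vdef : ℝ → ℝ) (ρ : ℝ) (hρ : 0 ≤ ρ)
    (hV : ContDiff ℝ ((⊤ : ℕ∞) : WithTop ℕ∞) V)
    (hsum : ∀ x : ℝ, V x = Vper x + Vdef x)
    (hper : ∀ x : ℝ, Vper (x + 1) = Vper x)
    (hdef : ∀ x : ℝ, ρ < |x| → Vdef x = 0)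
    (heven : ∀ x : ℝ, V (-x) = V x)
    (E : ℝ) (hE : 0 < E)
    (Φ : ℝ → ℂ) (hΦ : IsBoundState V E Φ)
    (u v : ℂ → ℝ → ℂ) (huv : IsNormalizedPair V Φ u v) :
    ∃ k : ℝ, 0 < k ∧
      IsGreatest {r : ℝ | ∃ μ : ℂ, IsFloquetMultiplier Vper E μ ∧ r = ‖μ‖} (Real.exp k) ∧
      ∃ C M₀ : ℝ, ρ < M₀ ∧ ∀ M : ℝ, M₀ ≤ M →
        DifferentiableAt ℂ (Theta u M) (E : ℂ) ∧
        deriv (Theta u M) (E : ℂ) ≠ 0 ∧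
        (deriv (v E) M ^ 2 + (E : ℂ) * v E M ^ 2) * (∫ y in (0 : ℝ)..M, u E y ^ 2) ≠ 0 ∧
        ‖Theta u M (E : ℂ) / deriv (Theta u M) (E : ℂ) - explicitCorrection u v E M‖
          ≤ C * (M * Real.exp (-4 * k * M)) := by
  have hVc : Continuous V := hV.continuous
  have hVρ : ∀ x, ρ < x → V x = Vper x := fun x hx => by
    rw [hsum, hdef x (hx.trans_le (le_abs_self x)), add_zero]
  have hVp : ∀ x, ρ < x → V (x + 1) = V x := fun x hx => by
    rw [hVρ x hx, hVρ (x + 1) (by linarith), hper]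
  obtain ⟨K, -, hK⟩ := exists_bound_of_periodic_Ioi (ρ := ρ)
    (g := fun x => ‖(V x : ℂ) - E‖) (by fun_prop) (fun x hx => by rw [hVp x hx])
  obtain ⟨hU, hvs, hw0, hur, hvr, hvr', hl, hl'⟩ :=
    huv.exists_common hΦ hVc heven fun x hx => hK x hx.le
  have hv := hvs.solvesOn univ
  have hW : ∀ x, u E x * deriv (v E) x - deriv (u E) x * v E x = 1 := hU.wronskian hv hw0
  have hu := hU.solves E
  have huI := hu.mono (subset_univ (Ioi ρ))
  have hvI := hv.mono (subset_univ (Ioi ρ))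
  obtain ⟨a, s, ha0, ha1, hua, hwa⟩ := huI.exists_floquet hvI
    (fun x hx => by rw [hVp x hx]) (fun x _ => hW x) hl hl'
  have hapos : 0 < ‖a‖ := norm_pos_iff.2 ha0
  have hexpk : Real.exp (-Real.log ‖a‖) = ‖a⁻¹‖ := by
    rw [Real.exp_neg, Real.exp_log hapos, norm_inv]
  have hcongr : ∀ x ∈ Ioi ρ, (V x : ℂ) - E = (Vper x : ℂ) - E := fun x hx => by rw [hVρ x hx]
  have hwI := hvI.add (huI.const_mul s)
  have hWw : ∀ x, u E x * (deriv (v E) x + s * deriv (u E) x)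
      - deriv (u E) x * (v E x + s * u E x) = 1 := fun x => by linear_combination hW x
  refine ⟨-Real.log ‖a‖, neg_pos.2 (Real.log_neg hapos ha1), ⟨⟨a⁻¹, ?_, hexpk⟩, ?_⟩, ?_⟩
  · refine (hwI.congr_potential hcongr).isFloquetMultiplier (inv_ne_zero ha0) hper
      (fun x hx => (hwa x hx).1) ?_
    -- If v + su vanished beyond ρ, so would its derivative, against its Wronskian one with u.
    by_contra! h
    have hx0 : ρ < ρ + 1 := by linarith
    have h1 := h (ρ + 1) hx0
    have h2 : deriv (v E) (ρ + 1) + s * deriv (u E) (ρ + 1) = 0 := by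
      refine (hwI (ρ + 1) hx0).1.unique
        ((hasDerivAt_const (ρ + 1) (0 : ℂ)).congr_of_eventuallyEq ?_)
      filter_upwards [lt_mem_nhds hx0] with x hx
      exact h x hx
    have h3 := hWw (ρ + 1)
    rw [h1, h2] at h3
    simp at h3
  · rintro _ ⟨μ, hμ, rfl⟩
    rw [hexpk]
    exact hμ.norm_le (huI.congr_potential hcongr) (hwI.congr_potential hcongr)
      (fun x _ => hWw x) ha0 ha1 hua hwa
  · obtain ⟨C₁, hC₁, hb₁⟩ := exists_exp_bound_of_shift hu.continuous ha0
      (fun x hx => (hua x hx).1)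
    obtain ⟨C₂, hC₂, hb₂⟩ := exists_exp_bound_of_shift hu.continuous' ha0
      (fun x hx => (hua x hx).2)
    obtain ⟨C₃, hC₃, hb₃⟩ := exists_exp_bound_of_shift
      (hv.add (hu.const_mul s)).continuous (inv_ne_zero ha0) (fun x hx => (hwa x hx).1)
    have hlog : Real.log ‖a‖ < 0 := Real.log_neg hapos ha1
    -- v = (v + su) - su: the first term is bounded by C₃e^{kx}, and the decaying second one a
    -- fortiori by |s|C₁e^{kx}.
    refine exists_expansion (C₁ := C₁) (C₂ := C₂) (C₃ := C₃ + ‖s‖ * C₁) hE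
      (neg_pos.2 hlog) hU hv hw0 hur hvr hvr' hC₁ hC₂ (by positivity)
      (fun x hx => by simpa using hb₁ x hx) (fun x hx => by simpa using hb₂ x hx)
      (fun x hx => ?_)
    have h1 := hb₃ x hx
    rw [norm_inv, Real.log_inv] at h1
    have h2 : Real.exp (Real.log ‖a‖ * x) ≤ Real.exp (-Real.log ‖a‖ * x) :=
      Real.exp_le_exp.2 (by nlinarith)
    calc ‖v E x‖ = ‖(v E x + s * u E x) - s * u E x‖ := by rw [add_sub_cancel_right]
      _ ≤ ‖v E x + s * u E x‖ + ‖s‖ * ‖u E x‖ := by rw [← norm_mul]; exact norm_sub_le _ _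
      _ ≤ C₃ * Real.exp (-Real.log ‖a‖ * x)
          + ‖s‖ * (C₁ * Real.exp (-Real.log ‖a‖ * x)) :=
        add_le_add h1 (mul_le_mul_of_nonneg_left
          ((hb₁ x hx).trans (mul_le_mul_of_nonneg_left h2 hC₁.le)) (norm_nonneg _))
      _ = (C₃ + ‖s‖ * C₁) * Real.exp (-Real.log ‖a‖ * x) := by ring
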